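/- Let $k$ be an algebraically closed field, $R=k[x,y,z]$ with the standard grading, and let $f\in R$ be a nonzero reduced form of degree $d+1\geq 2$ (that is, $(f)$ is a radical ideal), where $\operatorname{char}(k)$ does not divide $d+1$. Let $X=V(f)\subset\mathbb P^2_k$, let $J_f=(f_x,f_y,f_z)$ and let $\mathrm{Syz}(J_f)=\{(a,b,c)\in R^3 : af_x+bf_y+cf_z=0\}$, graded so that its degree $n$ part consists of the triples of forms of degree $n$. Let $e=\mathrm{indeg}(\mathrm{Syz}(J_f))$ be the least $n$ such that $\mathrm{Syz}(J_f)_n\neq 0$. For a minimal homogeneous generator $\epsilon$ of $\mathrm{Syz}(J_f)$ of degree $e$, a Bourbaki ideal of $X$ with respect to $\epsilon$ is a homogeneous ideal $I_\epsilon\subseteq R$, equal to $R$ or of codimension two, that fits into an exact sequence of graded $R$-modules $$0\to R(-e)\xrightarrow{\ \epsilon\ }\mathrm{Syz}(J_f)\to I_\epsilon(e-d)\to 0 .$$ The Bourbaki degree $\mathrm{Bour}(X)$ is the degree (multiplicity) of $R/I_\epsilon$, which is $0$ if $I_\epsilon=R$. If $X$ is singular, then such $\epsilon$ and $I_\epsilon$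 exist, $\deg(R/I_\epsilon)$ is the same for all choices of $\epsilon$ and $I_\epsilon$, so that $\mathrm{Bour}(X)$ is well defined, and $$\mathrm{Bour}(X)\leq e^2 .$$ -/

import Mathlib

open MvPolynomial

attribute [local instance] MvPolynomial.gradedAlgebra

namespace PlaneCurve

/-- The standard graded polynomial ring `R = k[x, y, z]`. -/
abbrev R (k : Type*) [Field k] := MvPolynomial (Fin 3) k

variable {k : Type*} [Field k]

/-- The first syzygy module `Syz(J_f)` of the partial derivatives of `f`: the triples
`(a, b, c)` in `R³` such that `a f_x + b f_y + c f_z = 0`. -/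
def Syz (f : R k) : Submodule (R k) (Fin 3 → R k) where
  carrier := {σ | ∑ i, σ i * pderiv i f = 0}
  add_mem' := by
    intro a b ha hb
    simp only [Set.mem_ofPred_eq] at *
    simp [add_mul, Finset.sum_add_distrib, ha, hb]
  zero_mem' := by simp
  smul_mem' := by
    intro c a ha
    simp only [Set.mem_ofPred_eq] at *
    simp [mul_assoc, ← Finset.mul_sum, ha]

/-- `σ ∈ R³` is homogeneous of standard degree `n`: all its coordinates are forms of degree `n`. -/
def IsHomogVec (σ : Fin 3 → R k) (n : ℕ) : Prop :=
  ∀ i, (σ i).IsHomogeneous n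

/-- The initial degree of `Syz(J_f)`: the least `n` such that `Syz(J_f)ₙ ≠ 0`. -/
noncomputable def indegSyz (f : R k) : ℕ :=
  sInf {n | ∃ σ ∈ Syz f, σ ≠ 0 ∧ IsHomogVec σ n}

/-- `ε` is a minimal homogeneous generator of `Syz(J_f)` of standard degree `e`, that is, a
homogeneous element which is not in `𝔪 Syz(J_f)`, where `𝔪 = (x, y, z)`. -/
def IsMinimalGenerator (f : R k) (e : ℕ) (ε : Syz f) : Prop :=
  IsHomogVec (ε : Fin 3 → R k) e ∧
    (ε : Fin 3 → R k) ∉ Ideal.span (Set.range (X : Fin 3 → R k)) • Syz f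

/-- `I` is a Bourbaki ideal of the curve `f = 0` of degree `d + 1` with respect to a syzygy `ε` of
degree `e`: it is a homogeneous ideal, either the unit ideal or of codimension two, which sits in
an exact sequence `0 → R(-e) → Syz(J_f) → I(e - d) → 0` of graded modules with first map `ε`.
In other words, `Syz(J_f) / R ε ≅ I(e - d)`. The last condition says that `u` maps elements of
degree `n` into `I(e - d)ₙ`, the degree `n + e - d` part of `I` (zero if `n + e - d < 0`). -/
def IsBourbakiIdeal (f : R k) (d e : ℕ) (ε : Syz f) (I : Ideal (R k)) : Prop :=
  I.IsHomogeneous (homogeneousSubmodule (Fin 3) k) ∧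
  (I = ⊤ ∨ I.height = 2) ∧
  ∃ u : Syz f →ₗ[R k] R k,
    LinearMap.ker u = Submodule.span (R k) {ε} ∧
    LinearMap.range u = I ∧
    ∀ (n : ℕ) (σ : Syz f), IsHomogVec (σ : Fin 3 → R k) n →
      u σ = 0 ∨ ∃ j : ℕ, j + d = n + e ∧ (u σ).IsHomogeneous j

/-- The Hilbert function `n ↦ dim_k (R/I)ₙ` of a homogeneous ideal `I`, where `(R/I)ₙ` is the
image of `Rₙ` in `R/I`. -/
noncomputable def hilbertFn (I : Ideal (R k)) (n : ℕ) : ℕ :=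
  Module.finrank k
    ((homogeneousSubmodule (Fin 3) k n).map (Ideal.Quotient.mkₐ k I).toLinearMap)

/-- For a homogeneous ideal `I` of codimension two (so that `dim R/I = 1`), the degree
(multiplicity) of `R/I` is the constant value of its Hilbert polynomial, i.e. the value of the
Hilbert function in all large degrees. For the unit ideal it is `0`. -/
def HasDegree (I : Ideal (R k)) (m : ℕ) : Prop :=
  ∀ᶠ n in Filter.atTop, hilbertFn I n = m

/-- `b` is the Bourbaki degree of the curve `f = 0` of degree `d + 1`: there is a minimal generator
`ε` of `Syz(J_f)` of initial degree with a Bourbaki ideal `I`, and `R/I` has degree `b` for every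
such `ε` and every such `I`. -/
def IsBourbakiDegree (f : R k) (d b : ℕ) : Prop :=
  (∃ (ε : Syz f) (I : Ideal (R k)),
    IsMinimalGenerator f (indegSyz f) ε ∧ IsBourbakiIdeal f d (indegSyz f) ε I) ∧
  ∀ (ε : Syz f) (I : Ideal (R k)),
    IsMinimalGenerator f (indegSyz f) ε → IsBourbakiIdeal f d (indegSyz f) ε I → HasDegree I b

/-- There is at most one Bourbaki degree. -/
theorem IsBourbakiDegree.unique {f : R k} {d b c : ℕ}
    (hb : IsBourbakiDegree f d b) (hc : IsBourbakiDegree f d c) : b = c := by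
  obtain ⟨⟨ε, I, h1, h2⟩, h⟩ := hb
  obtain ⟨n, hn, hn'⟩ := ((h ε I h1 h2).and (hc.2 ε I h1 h2)).exists
  exact hn.symm.trans hn'

/-- The plane projective curve `f = 0` has a singular point. -/
def IsSingular (f : R k) : Prop :=
  ∃ p : Fin 3 → k, p ≠ 0 ∧ eval p f = 0 ∧ ∀ i, eval p (pderiv i f) = 0

end PlaneCurve

/-!
Let `∇f` be the gradient of `f`, `e` the initial degree of `Syz(J_f)` and `𝔪 = (x, y, z)`. Call a
vector primitive if its coordinates have no common factor.

*Existence.* A common prime factor `q` of the partial derivatives divides `f` by Euler's formula;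
as `f` is squarefree, `q` divides its own derivatives, which is impossible over a perfect field. So
`∇f` is primitive (`isPrimitive_pderiv`). The minimal generators of degree `e` are the nonzero
elements `ε` of `Syz(J_f)ₑ` (`isMinimalGenerator_indegSyz_iff`), and they are primitive because a
common factor could be cancelled (`isPrimitive_of_isHomogVec_indegSyz`). For a syzygy `σ`, the cross
product `σ × ε` is parallel to `∇f`, so `σ × ε = u(σ) ∇f` defines a graded homomorphism `u` from
`Syz(J_f)` to `R` with kernel `R ε` (`exists_linearMap_cross_eq_smul`,
`ker_eq_span_of_cross_eq_smul`). Let `I` be its image. The Koszul syzygies show that `I` contains the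
coordinates of `ε` (`apply_mem_range_of_cross_eq_smul`), hence two coprime forms `p, q` of degree
`e`. This gives height at least two. Exactness of the Koszul complex of `x, y, z` shows that
`I : 𝔪 = I` (`mem_range_of_forall_X_mul_mem`), so that a proper `I` lies in a homogeneous prime other
than `𝔪`, and its height is at most two (`height_eq_two_of_colon`).

*The degree and its bound.* Since `p, q ∈ I`, the Hilbert function of `R/I` is at most `e²` in large
degrees (`hilbertFn_le_sq`). For a general linear form `l` the ideal `(p, q, l)` contains a power of
`𝔪` (`exists_linear_pow_le`), so multiplication by `l` is eventually surjective on `R/I` and the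
Hilbert function is eventually nonincreasing, hence eventually constant.

*Independence of the choices.* By rank-nullity in the Bourbaki sequence, the Hilbert function of
any Bourbaki ideal is determined in large degrees by the dimensions of the graded pieces of
`Syz(J_f)` and of `R`, and by `d` and `e` (`IsBourbakiIdeal.finrank_gradedPiece`).
-/

/-! ### Primitive vectors over a unique factorization domain -/

namespace PlaneCurve

open Matrix

/-- A vector is primitive if its coordinates have no common divisor other than units. -/
def IsPrimitive {A ι : Type*} [CommRing A] (v : ι → A) : Prop :=
  ∀ q, (∀ i, q ∣ v i) → IsUnit q

section UFD

variable {A ι : Type*} [CommRing A]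

theorem IsPrimitive.exists_ne_zero [Nontrivial A] {v : ι → A} (hv : IsPrimitive v) :
    ∃ i, v i ≠ 0 := by
  by_contra! h
  exact not_isUnit_zero (hv 0 fun i => by simp [h i])

/-- It suffices to test primitivity of a nonzero vector on prime elements. -/
theorem isPrimitive_of_forall_prime [IsDomain A] [UniqueFactorizationMonoid A] {v : ι → A}
    (h0 : ∃ i, v i ≠ 0) (h : ∀ p, Prime p → ¬ ∀ i, p ∣ v i) : IsPrimitive v := by
  intro q hq
  by_contra hu
  obtain ⟨i, hi⟩ := h0
  have hq0 : q ≠ 0 := fun h => hi (zero_dvd_iff.1 (h ▸ hq i))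
  obtain ⟨p, hp, hpq⟩ := WfDvdMonoid.exists_irreducible_factor hu hq0
  exact h p hp.prime fun i => hpq.trans (hq i)

/-- A vector parallel to a primitive vector is a multiple of it. -/
theorem IsPrimitive.exists_eq_smul [IsDomain A] [UniqueFactorizationMonoid A] [Finite ι]
    {v w : ι → A} (hv : IsPrimitive v) (h : ∀ i j, w i * v j = w j * v i) : ∃ u : A, w = u • v := by
  classical
  have := Fintype.ofFinite ι
  obtain ⟨i, hi⟩ := hv.exists_ne_zero
  let : StrongNormalizationMonoid A := UniqueFactorizationMonoid.strongNormalizationMonoid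
  let : StrongNormalizedGCDMonoid A := UniqueFactorizationMonoid.toStrongNormalizedGCDMonoid A
  have hg : IsUnit (Finset.univ.gcd v) :=
    hv _ fun j => Finset.gcd_dvd (Finset.mem_univ j)
  -- `v i` divides every `w i * v j = w j * v i`, hence it divides `w i * gcd v`.
  have h1 : v i ∣ Finset.univ.gcd fun j => w i * v j :=
    Finset.dvd_gcd fun j _ => ⟨w j, by rw [h i j, mul_comm]⟩
  rw [(Finset.gcd_mul_left' Finset.univ v (w i)).dvd_iff_dvd_right, hg.dvd_mul_right] at h1
  obtain ⟨u, hu⟩ := h1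
  refine ⟨u, funext fun j => mul_right_cancel₀ hi ?_⟩
  have := h i j
  simp only [Pi.smul_apply, smul_eq_mul]
  rw [← this, hu]
  ring

theorem IsPrimitive.exists_eq_smul_of_cross_eq_zero [IsDomain A] [UniqueFactorizationMonoid A]
    {v w : Fin 3 → A} (hv : IsPrimitive v) (h : w ⨯₃ v = 0) : ∃ u : A, w = u • v := by
  refine hv.exists_eq_smul fun i j => ?_
  have h0 := congrFun h 0
  have h1 := congrFun h 1
  have h2 := congrFun h 2
  simp only [cross_apply, Pi.zero_apply, cons_val] at h0 h1 h2
  fin_cases i <;> fin_cases j <;> simp only [Fin.zero_eta, Fin.mk_one, Fin.reduceFinMk]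
  · linear_combination h2
  · linear_combination -h1
  · linear_combination -h2
  · linear_combination h0
  · linear_combination h1
  · linear_combination -h0

/-- Over a unique factorization domain, two vectors orthogonal to a primitive vector `v` have
their cross product on the line of `v`. -/
theorem IsPrimitive.exists_cross_eq_smul [IsDomain A] [UniqueFactorizationMonoid A]
    {v a b : Fin 3 → A} (hv : IsPrimitive v) (ha : a ⬝ᵥ v = 0) (hb : b ⬝ᵥ v = 0) :
    ∃ u : A, a ⨯₃ b = u • v := by
  refine hv.exists_eq_smul_of_cross_eq_zero ?_
  rw [cross_cross_eq_smul_sub_smul, ha, hb]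
  simp

end UFD

/-! ### The syzygies of the variables -/

section Variables

variable {k : Type*} [Field k]

theorem isPrimitive_X : IsPrimitive (X : Fin 3 → R k) := by
  refine isPrimitive_of_forall_prime ⟨0, X_ne_zero 0⟩ fun p hp h => ?_
  have h0 : Associated p (X 0) := hp.irreducible.associated_of_dvd X_prime.irreducible (h 0)
  have h1 : (X 0 : R k) ∣ X 1 := h0.symm.dvd.trans (h 1)
  rw [X_dvd_X] at h1
  simp at h1

/-- Exactness of the Koszul complex of `x, y, z`: every syzygy of the variables is a cross
product with `(x, y, z)`. -/
theorem exists_eq_cross_of_dotProduct_X_eq_zero {c : Fin 3 → R k}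
    (h : c ⬝ᵥ (X : Fin 3 → R k) = 0) : ∃ b : Fin 3 → R k, c = (X : Fin 3 → R k) ⨯₃ b := by
  simp only [dotProduct, Fin.sum_univ_three] at h
  -- The ideal `(x, y)` is prime and does not contain `z`, so that `c 2 ∈ (x, y)`.
  have hz : c 2 ∈ Ideal.span ({X 0, X 1} : Set (R k)) := by
    have hI : ({X 0, X 1} : Set (R k)) = X '' {0, 1} := by simp [Set.image_pair]
    have h2 : c 2 * X 2 ∈ Ideal.span ({X 0, X 1} : Set (R k)) :=
      Ideal.mem_span_pair.2 ⟨-c 0, -c 1, by linear_combination -h⟩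
    rw [hI, mem_ideal_span_X_image] at h2 ⊢
    intro m hm
    obtain ⟨i, hi, hmi⟩ := h2 (m + Finsupp.single 2 1) (by
      rw [mem_support_iff, coeff_mul_X]
      exact mem_support_iff.1 hm)
    refine ⟨i, hi, ?_⟩
    rcases hi with rfl | rfl <;> simpa using hmi
  obtain ⟨s, t, hst⟩ := Ideal.mem_span_pair.1 hz
  have h' : (c 0 + s * X 2) * X 0 = -(c 1 + t * X 2) * X 1 := by
    linear_combination h + X 2 * hst
  have hd : (X 1 : R k) ∣ c 0 + s * X 2 := by
    refine (X_prime.dvd_or_dvd (Dvd.intro_left _ h'.symm)).resolve_right fun h => ?_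
    rw [X_dvd_X] at h
    simp at h
  obtain ⟨r, hr⟩ := hd
  have hr' : c 1 + t * X 2 = -(r * X 0) := by
    refine mul_right_cancel₀ (X_ne_zero (R := k) (1 : Fin 3)) ?_
    linear_combination h' - X 0 * hr
  refine ⟨![-t, s, r], funext fun i => ?_⟩
  fin_cases i <;>
    simp only [cross_apply, Fin.zero_eta, Fin.mk_one, Fin.reduceFinMk, cons_val]
  · linear_combination hr
  · linear_combination hr'
  · linear_combination -hst

end Variables

end PlaneCurve

/-! ### The gradient of a reduced form is primitive -/

namespace PlaneCurve

section Gradient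

variable {k σ : Type*} [Field k]

theorem eq_zero_of_dvd_pderiv {i : σ} {q : MvPolynomial σ k} (h : q ∣ pderiv i q) :
    pderiv i q = 0 := by
  by_contra h0
  obtain ⟨m, hm⟩ := exists_coeff_ne_zero h0
  obtain ⟨c, hc⟩ := h
  have hle : ∀ m ∈ q.support, m.degree ≤ q.totalDegree := fun m hm => le_totalDegree hm
  have hlt : (pderiv i q).totalDegree < q.totalDegree := by
    have hpos : 0 < q.totalDegree := by
      rw [coeff_pderiv] at hm
      refine lt_of_lt_of_le ?_ (hle _ (mem_support_iff.2 (left_ne_zero_of_mul hm)))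
      simp
    rw [totalDegree, Finset.sup_lt_iff hpos]
    intro m hm
    rw [mem_support_iff, coeff_pderiv] at hm
    have h1 := hle _ (mem_support_iff.2 (left_ne_zero_of_mul hm))
    have h2 : (m.sum fun _ e => e) = m.degree := rfl
    simp only [map_add, Finsupp.degree_single] at h1
    omega
  have hq : q ≠ 0 := by rintro rfl; simp at h0
  have hc0 : c ≠ 0 := by rintro rfl; simp [hc] at h0
  rw [hc, totalDegree_mul_of_isDomain hq hc0] at hlt
  omega

/-- Over a perfect field, an irreducible polynomial has a nonzero partial derivative: if all of
them vanish, the polynomial is a constant or a `p`-th power. -/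
theorem exists_pderiv_ne_zero_of_irreducible [PerfectField k] {q : MvPolynomial σ k}
    (hq : Irreducible q) : ∃ i, pderiv i q ≠ 0 := by
  by_contra! h
  have hm : ∀ m ∈ q.support, ∀ i, (m i : k) = 0 := by
    intro m hm i
    by_cases hmi : m i = 0
    · simp [hmi]
    have h1 := congrArg (coeff (m - Finsupp.single i 1)) (h i)
    have h2 : m - Finsupp.single i 1 + Finsupp.single i 1 = m :=
      tsub_add_cancel_of_le (by simpa using Nat.one_le_iff_ne_zero.2 hmi)
    rw [coeff_pderiv, h2, coeff_zero] at h1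
    have h3 := (mul_eq_zero.1 h1).resolve_left (mem_support_iff.1 hm)
    rw [← h3]
    simp only [Finsupp.tsub_apply, Finsupp.single_eq_same]
    rw [Nat.cast_sub (Nat.one_le_iff_ne_zero.2 hmi)]
    simp
  obtain ⟨p, hp⟩ := ExpChar.exists k
  rcases hp with _ | ⟨hp⟩
  · refine hq.not_isUnit ?_
    have : q.totalDegree = 0 := (totalDegree_eq_zero_iff σ q).2 fun m h i => by
      exact_mod_cast hm m h i
    rw [totalDegree_eq_zero_iff_eq_C.1 this]
    have h0 : coeff 0 q ≠ 0 := fun h0 => hq.ne_zero (by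
      rw [totalDegree_eq_zero_iff_eq_C.1 this, h0, C_0])
    exact (isUnit_iff_ne_zero.2 h0).map C
  · have : Fact p.Prime := ⟨hp⟩
    have : PerfectRing k p := PerfectField.toPerfectRing p
    have hroot : ∀ m : σ →₀ ℕ, ∃ g : MvPolynomial σ k, m ∈ q.support →
        g ^ p = monomial m (coeff m q) := by
      intro m
      obtain ⟨c, hc⟩ := surjective_frobenius k p (coeff m q)
      refine ⟨monomial (m.mapRange (· / p) (Nat.zero_div p)) c, fun hmq => ?_⟩
      rw [monomial_pow, ← hc, frobenius_def]
      have hpm : p • m.mapRange (· / p) (Nat.zero_div p) = m := by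
        ext i
        simp [Nat.mul_div_cancel' ((CharP.cast_eq_zero_iff k p (m i)).1 (hm m hmq i))]
      rw [hpm]
    choose g hg using hroot
    have hpow : (∑ m ∈ q.support, g m) ^ p = q := by
      rw [sum_pow_char]
      conv_rhs => rw [← support_sum_monomial_coeff q]
      exact Finset.sum_congr rfl fun m hmq => hg m hmq
    exact not_irreducible_pow hp.ne_one (hpow ▸ hq)

end Gradient

/-- A prime factor `q` common to the partial derivatives divides `f` by Euler's formula. As `f` is
squarefree, `q` divides its own derivatives, so they all vanish. -/
theorem isPrimitive_pderiv {k : Type*} [Field k] [PerfectField k] {n : ℕ} {f : R k}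
    (hf : f.IsHomogeneous n) (hn : (n : k) ≠ 0) (hf0 : f ≠ 0) (hsq : Squarefree f) :
    IsPrimitive fun i => pderiv i f := by
  have euler : C (n : k) * f = ∑ i, X i * pderiv i f := by
    rw [hf.sum_X_mul_pderiv]; simp [nsmul_eq_mul]
  have hu : IsUnit (C (n : k) : R k) := (isUnit_iff_ne_zero.2 hn).map C
  refine isPrimitive_of_forall_prime ?_ fun q hq h => ?_
  · by_contra! h
    simp only [h, mul_zero, Finset.sum_const_zero] at euler
    exact mul_ne_zero hu.ne_zero hf0 euler
  · have hqf : q ∣ f := by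
      rw [← hu.dvd_mul_left, euler]
      exact Finset.dvd_sum fun i _ => (h i).mul_left _
    obtain ⟨g, rfl⟩ := hqf
    have hqg : ¬ q ∣ g := fun hd => hq.not_isUnit (hsq q (mul_dvd_mul_left q hd))
    obtain ⟨i, hi⟩ := exists_pderiv_ne_zero_of_irreducible hq.irreducible
    refine hi (eq_zero_of_dvd_pderiv ?_)
    have := h i
    rw [pderiv_mul, dvd_add_left (dvd_mul_right q _)] at this
    exact (hq.dvd_or_dvd this).resolve_right hqg

end PlaneCurve

/-! ### The grading of the syzygy module -/

namespace PlaneCurve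

open Matrix

variable {k : Type*} [Field k]

theorem homogeneousComponent_mul_of_isHomogeneous {σ : Type*} {a b : MvPolynomial σ k} {e : ℕ}
    (hb : b.IsHomogeneous e) (n : ℕ) :
    homogeneousComponent (n + e) (a * b) = homogeneousComponent n a * b := by
  have h := DirectSum.coe_decompose_mul_add_of_right_mem (homogeneousSubmodule σ k)
    (i := n) (a := a) hb
  rwa [← decomposition.decompose'_apply, ← decomposition.decompose'_apply]

/-- If `a * b` and `b ≠ 0` are homogeneous, so is `a`. The degree of `a` only makes sense for
`a ≠ 0`, since that of `a * b` may be less than that of `b` when `a = 0`. -/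
theorem eq_zero_or_exists_isHomogeneous_of_mul {σ : Type*} {a b : MvPolynomial σ k} {e n : ℕ}
    (hb : b.IsHomogeneous e) (hb0 : b ≠ 0) (hab : (a * b).IsHomogeneous n) :
    a = 0 ∨ ∃ j, j + e = n ∧ a.IsHomogeneous j := by
  have h0 : ∀ m, m + e ≠ n → homogeneousComponent m a = 0 := fun m hm => by
    have h := homogeneousComponent_mul_of_isHomogeneous (a := a) hb m
    rw [homogeneousComponent_of_mem hab, if_neg hm] at h
    exact (mul_eq_zero.1 h.symm).resolve_right hb0
  by_cases hn : ∃ j, j + e = n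
  · obtain ⟨j, hj⟩ := hn
    refine Or.inr ⟨j, hj, ?_⟩
    have ha : a = homogeneousComponent j a := by
      conv_lhs => rw [← sum_homogeneousComponent a]
      rw [Finset.sum_eq_single j (fun m _ hm => h0 m (by omega))]
      intro hj
      exact homogeneousComponent_eq_zero _ _ (by simpa using hj)
    rw [ha]
    exact homogeneousComponent_isHomogeneous _ _
  · push Not at hn
    left
    rw [← sum_homogeneousComponent a]
    exact Finset.sum_eq_zero fun m _ => h0 m (hn m)

/-- The degree `n` component of a vector of polynomials. -/
noncomputable def vecComponent (n : ℕ) (v : Fin 3 → R k) : Fin 3 → R k :=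
  fun i => homogeneousComponent n (v i)

theorem isHomogVec_vecComponent (n : ℕ) (v : Fin 3 → R k) : IsHomogVec (vecComponent n v) n :=
  fun _ => homogeneousComponent_isHomogeneous _ _

theorem IsHomogVec.vecComponent_eq {v : Fin 3 → R k} {n : ℕ} (h : IsHomogVec v n) :
    vecComponent n v = v :=
  funext fun i => homogeneousComponent_eq_self (h i)

/-- A vector of polynomials is the sum of its components up to any sufficiently large degree. -/
theorem exists_forall_sum_vecComponent (v : Fin 3 → R k) :
    ∃ N, ∀ M, N ≤ M → ∑ n ∈ Finset.range M, vecComponent n v = v := by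
  refine ⟨(Finset.univ.sup fun i => (v i).totalDegree) + 1, fun M hM => funext fun i => ?_⟩
  have hi : (v i).totalDegree + 1 ≤ M :=
    (Nat.succ_le_succ (Finset.le_sup (f := fun i => (v i).totalDegree) (Finset.mem_univ i))).trans
      hM
  rw [Finset.sum_apply]
  conv_rhs => rw [← sum_homogeneousComponent (v i)]
  refine (Finset.sum_subset (Finset.range_mono hi) fun n _ hn => ?_).symm
  exact homogeneousComponent_eq_zero _ _ (by simpa using hn)

theorem exists_vecComponent_ne_zero {v : Fin 3 → R k} (hv : v ≠ 0) :
    ∃ n, vecComponent n v ≠ 0 := by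
  by_contra! h
  obtain ⟨N, hN⟩ := exists_forall_sum_vecComponent v
  exact hv (by rw [← hN N le_rfl]; simp [h])

theorem mem_syz_iff {f : R k} {v : Fin 3 → R k} :
    v ∈ Syz f ↔ v ⬝ᵥ (fun i => pderiv i f) = 0 := Iff.rfl

theorem vecComponent_mem_syz {f : R k} {d : ℕ} (hf : f.IsHomogeneous (d + 1))
    {v : Fin 3 → R k} (hv : v ∈ Syz f) (n : ℕ) : vecComponent n v ∈ Syz f := by
  have h := congrArg (homogeneousComponent (n + d)) (mem_syz_iff.1 hv)
  rw [dotProduct, map_sum, map_zero] at h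
  rw [mem_syz_iff, dotProduct, ← h]
  exact Finset.sum_congr rfl fun i _ =>
    (homogeneousComponent_mul_of_isHomogeneous (hf.pderiv (i := i)) n).symm

/-! ### Syzygies of initial degree -/

section InitialDegree

variable {f : R k} {d : ℕ}

theorem cross_mem_syz (f : R k) (v : Fin 3 → R k) : (fun i => pderiv i f) ⨯₃ v ∈ Syz f := by
  rw [mem_syz_iff, dotProduct_comm]
  exact dot_self_cross _ _

/-- The Koszul syzygies show that the initial degree is attained. -/
theorem exists_isHomogVec_indegSyz (hf : f.IsHomogeneous (d + 1))
    (h0 : ∃ i, pderiv i f ≠ 0) : ∃ ε ∈ Syz f, ε ≠ 0 ∧ IsHomogVec ε (indegSyz f) := by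
  refine Nat.sInf_mem (s := {n | ∃ σ ∈ Syz f, σ ≠ 0 ∧ IsHomogVec σ n}) ?_
  obtain ⟨v, hv⟩ : ∃ v : Fin 3 → R k, (fun i => pderiv i f) ⨯₃ v ≠ 0 := by
    by_contra! h
    have h1 := h ![1, 0, 0]
    have h2 := h ![0, 1, 0]
    obtain ⟨i, hi⟩ := h0
    have e1 := congrFun h1 1
    have e2 := congrFun h1 2
    have e3 := congrFun h2 2
    simp [cross_apply] at e1 e2 e3
    fin_cases i <;> simp_all
  obtain ⟨n, hn⟩ := exists_vecComponent_ne_zero hv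
  exact ⟨n, _, vecComponent_mem_syz hf (cross_mem_syz f v) n, hn, isHomogVec_vecComponent _ _⟩

theorem eq_zero_of_lt_indegSyz {v : Fin 3 → R k} {n : ℕ} (hn : n < indegSyz f) (hv : v ∈ Syz f)
    (h : IsHomogVec v n) : v = 0 := by
  by_contra h0
  exact Nat.notMem_of_lt_sInf hn ⟨v, hv, h0, h⟩

theorem vecComponent_eq_zero_of_mem_smul (hf : f.IsHomogeneous (d + 1)) {v : Fin 3 → R k}
    (hv : v ∈ Ideal.span (Set.range (X : Fin 3 → R k)) • Syz f) :
    ∀ n ≤ indegSyz f, vecComponent n v = 0 := by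
  refine Submodule.smul_induction_on hv (fun a ha => ?_) (fun v w hv hw n hn => ?_)
  · refine Submodule.span_induction (p := fun a _ => ∀ w ∈ Syz f, ∀ n ≤ indegSyz f,
      vecComponent n (a • w) = 0) ?_ ?_ ?_ ?_ ha
    · rintro _ ⟨i, rfl⟩ w hw n hn
      ext1 j
      simp only [vecComponent, Pi.smul_apply, smul_eq_mul, Pi.zero_apply]
      rcases n with _ | n
      · rw [homogeneousComponent_zero, ← constantCoeff_eq, map_mul, constantCoeff_X, zero_mul, C_0]
      · have h := congrFun (eq_zero_of_lt_indegSyz hn (vecComponent_mem_syz hf hw n)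
          (isHomogVec_vecComponent n w)) j
        rw [mul_comm, homogeneousComponent_mul_of_isHomogeneous (isHomogeneous_X k i)]
        rw [vecComponent, Pi.zero_apply] at h
        rw [h, zero_mul]
    · intro w _ n _
      ext1 j
      simp [vecComponent]
    · intro a b _ _ ha hb w hw n hn
      have h1 := ha w hw n hn
      have h2 := hb w hw n hn
      ext1 j
      have h1 := congrFun h1 j
      have h2 := congrFun h2 j
      simp only [vecComponent, Pi.smul_apply, smul_eq_mul, Pi.zero_apply] at h1 h2 ⊢
      rw [add_mul, map_add, h1, h2, add_zero]
    · intro c a _ ha w hw n hn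
      have h1 := ha (c • w) ((Syz f).smul_mem c hw) n hn
      rwa [smul_eq_mul, mul_comm, mul_smul]
  · ext1 j
    have h1 := congrFun (hv n hn) j
    have h2 := congrFun (hw n hn) j
    simp only [vecComponent, Pi.add_apply, Pi.zero_apply] at h1 h2 ⊢
    rw [map_add, h1, h2, add_zero]

/-- The minimal generators of initial degree `e` are the nonzero elements of `Syz(J_f)ₑ`. -/
theorem isMinimalGenerator_indegSyz_iff (hf : f.IsHomogeneous (d + 1)) {ε : Syz f} :
    IsMinimalGenerator f (indegSyz f) ε ↔
      IsHomogVec (ε : Fin 3 → R k) (indegSyz f) ∧ (ε : Fin 3 → R k) ≠ 0 := by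
  refine and_congr_right fun h => not_congr ⟨fun hm => ?_, fun h0 => h0 ▸ Submodule.zero_mem _⟩
  rw [← h.vecComponent_eq]
  exact vecComponent_eq_zero_of_mem_smul hf hm _ le_rfl

/-- Dividing a syzygy of initial degree by a common divisor of positive degree would lead to
syzygies of smaller degree. -/
theorem isPrimitive_of_isHomogVec_indegSyz (hf : f.IsHomogeneous (d + 1)) {ε : Fin 3 → R k}
    (hε : ε ∈ Syz f) (hε0 : ε ≠ 0) (h : IsHomogVec ε (indegSyz f)) : IsPrimitive ε := by
  intro q hq
  choose τ hτ using hq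
  obtain ⟨i, hi⟩ := Function.ne_iff.1 hε0
  have hq0 : q ≠ 0 := by
    rintro rfl
    simp [hτ] at hi
  have hετ : ε = q • τ := funext hτ
  have hτ0 : τ ≠ 0 := by
    rintro rfl
    simp [hτ] at hi
  have hτS : τ ∈ Syz f := by
    rw [hετ, mem_syz_iff, smul_dotProduct, smul_eq_mul] at hε
    exact (mul_eq_zero.1 hε).resolve_left hq0
  obtain ⟨n, hn⟩ := exists_vecComponent_ne_zero hτ0
  have hen : indegSyz f ≤ n := by
    by_contra! hlt
    exact hn (eq_zero_of_lt_indegSyz hlt (vecComponent_mem_syz hf hτS n)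
      (isHomogVec_vecComponent n τ))
  obtain ⟨j, hj⟩ := Function.ne_iff.1 hn
  have hτj : τ j ≠ 0 := fun h0 => hj (by simp [vecComponent, h0])
  have h1 : n ≤ (τ j).totalDegree := by
    by_contra! hlt
    exact hj (homogeneousComponent_eq_zero _ _ hlt)
  have h2 : (ε j).totalDegree ≤ indegSyz f := (h j).totalDegree_le
  rw [hτ j, totalDegree_mul_of_isDomain hq0 hτj] at h2
  have hq1 := totalDegree_eq_zero_iff_eq_C.1 (show q.totalDegree = 0 by omega)
  rw [hq1] at hq0 ⊢
  exact (isUnit_iff_ne_zero.2 fun h0 => hq0 (by rw [h0, C_0])).map C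

end InitialDegree

/-! ### The Bourbaki ideal of a syzygy of initial degree -/

section Construction

variable {f : R k} {d : ℕ}

/-- The map `u` of the Bourbaki sequence: `σ × ε` is orthogonal to `σ` and `ε`, as is the gradient
of `f`, so that `σ × ε = u(σ) ∇f`. -/
theorem exists_linearMap_cross_eq_smul (hprim : IsPrimitive fun i => pderiv i f)
    {ε : Fin 3 → R k} (hε : ε ∈ Syz f) :
    ∃ u : Syz f →ₗ[R k] R k, ∀ σ : Syz f,
      (σ : Fin 3 → R k) ⨯₃ ε = u σ • fun i => pderiv i f := by
  choose u hu using fun σ : Syz f =>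
    hprim.exists_cross_eq_smul (mem_syz_iff.1 σ.2) (mem_syz_iff.1 hε)
  obtain ⟨i, hi⟩ := hprim.exists_ne_zero
  have hinj : ∀ a b : R k, a • (fun i => pderiv i f) = b • (fun i => pderiv i f) → a = b :=
    fun a b h => mul_right_cancel₀ hi (congrFun h i)
  exact ⟨{
    toFun := u
    map_add' σ τ := hinj _ _ (by
      rw [← hu, add_smul, ← hu, ← hu, Submodule.coe_add, map_add, LinearMap.add_apply])
    map_smul' r σ := hinj _ _ (by
      rw [← hu, RingHom.id_apply, smul_assoc, ← hu, Submodule.coe_smul, map_smul,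
        LinearMap.smul_apply]) }, hu⟩

variable {ε : Syz f} {u : Syz f →ₗ[R k] R k}

theorem ker_eq_span_of_cross_eq_smul (hprim : IsPrimitive fun i => pderiv i f)
    (hε : IsPrimitive (ε : Fin 3 → R k))
    (hu : ∀ σ : Syz f, (σ : Fin 3 → R k) ⨯₃ (ε : Fin 3 → R k) = u σ • fun i => pderiv i f) :
    LinearMap.ker u = Submodule.span (R k) {ε} := by
  ext σ
  rw [LinearMap.mem_ker, Submodule.mem_span_singleton]
  constructor
  · intro h
    obtain ⟨r, hr⟩ := hε.exists_eq_smul_of_cross_eq_zero (w := σ) (by rw [hu, h, zero_smul])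
    exact ⟨r, Subtype.ext hr.symm⟩
  · rintro ⟨r, rfl⟩
    obtain ⟨i, hi⟩ := hprim.exists_ne_zero
    have h := congrFun (hu (r • ε)) i
    rw [Submodule.coe_smul, map_smul, LinearMap.smul_apply, cross_self, smul_zero] at h
    exact (mul_eq_zero.1 h.symm).resolve_right hi

/-- The Koszul syzygies `∇f × v` are mapped to `-⟨v, ε⟩`, so the Bourbaki ideal contains the
coordinates of `ε`. -/
theorem apply_mem_range_of_cross_eq_smul (hprim : IsPrimitive fun i => pderiv i f)
    (hu : ∀ σ : Syz f, (σ : Fin 3 → R k) ⨯₃ (ε : Fin 3 → R k) = u σ • fun i => pderiv i f)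
    (i : Fin 3) : (ε : Fin 3 → R k) i ∈ LinearMap.range u := by
  obtain ⟨j, hj⟩ := hprim.exists_ne_zero
  refine ⟨⟨_, cross_mem_syz f (-Pi.single i 1)⟩, mul_right_cancel₀ hj ?_⟩
  have h := congrFun (hu ⟨_, cross_mem_syz f (-Pi.single i 1)⟩) j
  rw [cross_cross_eq_smul_sub_smul, dotProduct_comm, mem_syz_iff.1 ε.2] at h
  simpa using h.symm

theorem isHomogeneous_of_cross_eq_smul (hf : f.IsHomogeneous (d + 1))
    (hprim : IsPrimitive fun i => pderiv i f) {e : ℕ} (hε : IsHomogVec (ε : Fin 3 → R k) e)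
    (hu : ∀ σ : Syz f, (σ : Fin 3 → R k) ⨯₃ (ε : Fin 3 → R k) = u σ • fun i => pderiv i f)
    (n : ℕ) (σ : Syz f) (hσ : IsHomogVec (σ : Fin 3 → R k) n) :
    u σ = 0 ∨ ∃ j : ℕ, j + d = n + e ∧ (u σ).IsHomogeneous j := by
  obtain ⟨i, hi⟩ := hprim.exists_ne_zero
  refine eq_zero_or_exists_isHomogeneous_of_mul (hf.pderiv (i := i)) hi ?_
  have h := congrFun (hu σ) i
  rw [Pi.smul_apply, smul_eq_mul] at h
  rw [← h, cross_apply]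
  fin_cases i <;> exact ((hσ _).mul (hε _)).sub ((hσ _).mul (hε _))

/-- The ideal `I = u(Syz(J_f))`, where `u` has kernel `R ε`, satisfies `I : 𝔪 = I` for
`𝔪 = (x, y, z)`: if `x g, y g, z g` are the images of syzygies `σ₀, σ₁, σ₂`, then `xⱼ σᵢ - xᵢ σⱼ`
are multiples of `ε`. By Koszul exactness, `σᵢ` may be changed by multiples of `ε` so that
`xⱼ σᵢ = xᵢ σⱼ`, which means that `σᵢ = xᵢ τ` for a syzygy `τ`, and `u τ = g`. -/
theorem mem_range_of_forall_X_mul_mem (hε : (ε : Fin 3 → R k) ≠ 0)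
    (hker : LinearMap.ker u = Submodule.span (R k) {ε}) {g : R k}
    (hg : ∀ i, X i * g ∈ LinearMap.range u) : g ∈ LinearMap.range u := by
  choose σ hσ using hg
  have hε0 : ε ≠ 0 := fun h => hε (by rw [h]; rfl)
  have hc : ∀ i j, ∃ c : R k, c • ε = (X j : R k) • σ i - (X i : R k) • σ j := fun i j => by
    refine Submodule.mem_span_singleton.1 ?_
    rw [← hker, LinearMap.mem_ker, map_sub, map_smul, map_smul, hσ, hσ, smul_eq_mul, smul_eq_mul]
    ring
  obtain ⟨c₀, h₀⟩ := hc 1 2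
  obtain ⟨c₁, h₁⟩ := hc 2 0
  obtain ⟨c₂, h₂⟩ := hc 0 1
  obtain ⟨b, hb⟩ := exists_eq_cross_of_dotProduct_X_eq_zero (c := ![c₀, c₁, c₂]) (by
    refine (smul_eq_zero.1 (?_ : _ • ε = 0)).resolve_right hε0
    simp only [dotProduct, Fin.sum_univ_three, cons_val]
    rw [add_smul, add_smul, mul_comm c₀, mul_comm c₁, mul_comm c₂, mul_smul, mul_smul, mul_smul,
      h₀, h₁, h₂]
    module)
  have hb0 := congrFun hb 0
  have hb1 := congrFun hb 1
  have hb2 := congrFun hb 2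
  simp only [cross_apply, cons_val] at hb0 hb1 hb2
  have hcross : ∀ l, (fun i => (σ i : Fin 3 → R k) l + b i * (ε : Fin 3 → R k) l) ⨯₃
      (X : Fin 3 → R k) = 0 := by
    intro l
    have e₀ := congrFun (congrArg Subtype.val h₀) l
    have e₁ := congrFun (congrArg Subtype.val h₁) l
    have e₂ := congrFun (congrArg Subtype.val h₂) l
    simp only [Submodule.coe_smul, Submodule.coe_sub, Pi.smul_apply, Pi.sub_apply,
      smul_eq_mul] at e₀ e₁ e₂
    ext1 i
    fin_cases i <;>
      simp only [cross_apply, Fin.zero_eta, Fin.mk_one, Fin.reduceFinMk, cons_val, Pi.zero_apply]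
    · linear_combination -e₀ + (ε : Fin 3 → R k) l * hb0
    · linear_combination -e₁ + (ε : Fin 3 → R k) l * hb1
    · linear_combination -e₂ + (ε : Fin 3 → R k) l * hb2
  choose τ hτ using fun l => isPrimitive_X.exists_eq_smul_of_cross_eq_zero (hcross l)
  have hτi : ∀ i, (X i : R k) • τ = (σ i : Fin 3 → R k) + b i • (ε : Fin 3 → R k) := fun i =>
    funext fun l => by
      have := congrFun (hτ l) i
      simp only [Pi.smul_apply, smul_eq_mul, Pi.add_apply] at this ⊢
      rw [this, mul_comm]
  have hτS : τ ∈ Syz f := by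
    have h : (X 0 : R k) • τ ∈ Syz f := by
      rw [hτi]
      exact (Syz f).add_mem (σ 0).2 ((Syz f).smul_mem _ ε.2)
    rw [mem_syz_iff, smul_dotProduct, smul_eq_mul] at h
    exact (mul_eq_zero.1 h).resolve_left (X_ne_zero 0)
  refine ⟨⟨τ, hτS⟩, mul_left_cancel₀ (X_ne_zero (R := k) (0 : Fin 3)) ?_⟩
  have huε : u ε = 0 := by
    rw [← LinearMap.mem_ker, hker]
    exact Submodule.mem_span_singleton_self ε
  rw [← hσ 0, ← smul_eq_mul, ← map_smul,
    show (X 0 : R k) • (⟨τ, hτS⟩ : Syz f) = σ 0 + b 0 • ε from Subtype.ext (hτi 0), map_add,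
    map_smul, huε, smul_zero, add_zero]

end Construction

end PlaneCurve

/-! ### Heights of homogeneous ideals -/

namespace PlaneCurve

variable {k : Type*} [Field k]

theorem mem_idealOfVars_iff {σ : Type*} {g : MvPolynomial σ k} :
    g ∈ idealOfVars σ k ↔ constantCoeff g = 0 := by
  rw [← pow_one (idealOfVars σ k), mem_pow_idealOfVars_iff', constantCoeff_eq]
  refine ⟨fun h => h 0 (by simp), fun h m hm => ?_⟩
  rw [Nat.lt_one_iff, Finsupp.degree_eq_zero_iff] at hm
  rw [hm, h]

instance isMaximal_idealOfVars {σ : Type*} : (idealOfVars σ k).IsMaximal := by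
  have h : idealOfVars σ k = RingHom.ker (constantCoeff : MvPolynomial σ k →+* k) :=
    Ideal.ext fun g => mem_idealOfVars_iff
  rw [h]
  exact RingHom.ker_isMaximal_of_surjective _ fun c => ⟨C c, constantCoeff_C _ _⟩

theorem le_idealOfVars_of_isHomogeneous {σ : Type*} {I : Ideal (MvPolynomial σ k)}
    (hI : I.IsHomogeneous (homogeneousSubmodule σ k)) (hI' : I ≠ ⊤) : I ≤ idealOfVars σ k := by
  intro g hg
  rw [mem_idealOfVars_iff]
  by_contra h0
  have h := homogeneousComponent_mem_of_mem hI hg 0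
  rw [homogeneousComponent_zero, ← constantCoeff_eq] at h
  exact hI' (Ideal.eq_top_of_isUnit_mem _ h ((isUnit_iff_ne_zero.2 h0).map C))

theorem height_idealOfVars_le : (idealOfVars (Fin 3) k).height ≤ 3 := by
  have h := Ideal.height_le_card_of_mem_minimalPrimes_span
    (p := idealOfVars (Fin 3) k) (Set.finite_range (X : Fin 3 → R k))
    (by rw [← idealOfVars, Ideal.minimalPrimes_eq_subsingleton_self]; rfl)
  refine h.trans ?_
  have : (Set.range (X : Fin 3 → R k)).ncard ≤ 3 := by
    rw [← Set.image_univ]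
    exact (Set.ncard_image_le Set.finite_univ).trans (by simp)
  exact_mod_cast this

theorem height_le_two_of_isHomogeneous {Q : Ideal (R k)} [Q.IsPrime]
    (hQ : Q.IsHomogeneous (homogeneousSubmodule (Fin 3) k)) (hQ' : Q ≠ idealOfVars (Fin 3) k) :
    Q.height ≤ 2 := by
  have hlt : Q < idealOfVars (Fin 3) k :=
    (le_idealOfVars_of_isHomogeneous hQ Ideal.IsPrime.ne_top').lt_of_ne hQ'
  have h := (Ideal.height_add_one_le_of_lt_of_isPrime hlt).trans height_idealOfVars_le
  rw [show (3 : ℕ∞) = 2 + 1 from rfl] at h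
  exact (ENat.add_le_add_iff_right (by simp)).1 h

/-- A prime containing two coprime polynomials `p` and `q` strictly contains the prime generated by
an irreducible factor of `p`, so its height is at least two. -/
theorem two_le_height_of_isRelPrime {P : Ideal (R k)} [P.IsPrime] {p q : R k} (hp0 : p ≠ 0)
    (h : IsRelPrime p q) (hp : p ∈ P) (hq : q ∈ P) : 2 ≤ P.height := by
  obtain ⟨π, hπ, hπp, hπP⟩ : ∃ π, Prime π ∧ π ∣ p ∧ π ∈ P := by
    obtain ⟨s, hs, hsp⟩ := UniqueFactorizationMonoid.exists_prime_factors p hp0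
    have h1 : s.prod ∈ P := by
      obtain ⟨c, hc⟩ := hsp.symm
      rw [← hc]
      exact P.mul_mem_right _ hp
    obtain ⟨π, hπs, hπ⟩ := (Ideal.IsPrime.multiset_prod_mem_iff_exists_mem ‹_› s).1 h1
    exact ⟨π, hs π hπs, (Multiset.dvd_prod hπs).trans hsp.dvd, hπ⟩
  have : (Ideal.span {π}).IsPrime := (Ideal.span_singleton_prime hπ.ne_zero).2 hπ
  have h1 : (⊥ : Ideal (R k)) < Ideal.span {π} := by
    rw [bot_lt_iff_ne_bot, Ne, Ideal.span_singleton_eq_bot]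
    exact hπ.ne_zero
  have h2 : Ideal.span {π} < P := by
    refine lt_of_le_of_ne ((Ideal.span_singleton_le_iff_mem _).2 hπP) fun heq => ?_
    rw [← heq, Ideal.mem_span_singleton] at hq
    exact hπ.not_isUnit (h hπp hq)
  have h3 := Ideal.height_add_one_le_of_lt_of_isPrime h1
  have h4 := Ideal.height_add_one_le_of_lt_of_isPrime h2
  calc (2 : ℕ∞) = 0 + 1 + 1 := rfl
    _ ≤ (⊥ : Ideal (R k)).height + 1 + 1 := by gcongr; exact zero_le
    _ ≤ (Ideal.span {π}).height + 1 := by gcongr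
    _ ≤ P.height := h4

/-- A proper homogeneous ideal `I` with `I : 𝔪 = I` is contained in a homogeneous prime other than
`𝔪`, which has height at most two. -/
theorem height_eq_two_of_colon {I : Ideal (R k)}
    (hI : I.IsHomogeneous (homogeneousSubmodule (Fin 3) k)) (hI' : I ≠ ⊤) {p q : R k}
    (hp0 : p ≠ 0) (hpq : IsRelPrime p q) (hp : p ∈ I) (hq : q ∈ I)
    (hcolon : ∀ g, (∀ i, X i * g ∈ I) → g ∈ I) : I.height = 2 := by
  refine le_antisymm ?_ ?_
  · have hrad : ¬ idealOfVars (Fin 3) k ≤ I.radical := by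
      intro hle
      obtain ⟨N, hN⟩ := Ideal.exists_pow_le_of_le_radical_of_fg hle (idealOfVars_fg (Fin 3) k)
      have hdesc : ∀ N, idealOfVars (Fin 3) k ^ N ≤ I → idealOfVars (Fin 3) k ^ 0 ≤ I := by
        intro N
        induction N with
        | zero => exact id
        | succ N ih =>
          refine fun h => ih fun g hg => hcolon g fun i => h ?_
          rw [pow_succ']
          exact Ideal.mul_mem_mul (Ideal.subset_span ⟨i, rfl⟩) hg
      exact hI' (by simpa using hdesc N hN)
    rw [Ideal.radical_eq_sInf, le_sInf_iff] at hrad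
    push Not at hrad
    obtain ⟨P, ⟨hIP, hP⟩, hmP⟩ := hrad
    have hQ := hP.homogeneousCore (𝒜 := homogeneousSubmodule (Fin 3) k)
    have hIQ : I ≤ (P.homogeneousCore (homogeneousSubmodule (Fin 3) k)).toIdeal := by
      rw [← hI.toIdeal_homogeneousCore_eq_self]
      exact Ideal.homogeneousCore_mono _ hIP
    refine (Ideal.height_mono hIQ).trans (height_le_two_of_isHomogeneous
      (HomogeneousIdeal.isHomogeneous _) fun h => hmP ?_)
    rw [← h]
    exact Ideal.toIdeal_homogeneousCore_le _ _
  · rw [Ideal.height_eq_inf_minimalPrimes]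
    refine le_iInf₂ fun P hP => ?_
    have := hP.isPrime
    exact two_le_height_of_isRelPrime hp0 hpq (hP.1.2 hp) (hP.1.2 hq)

/-! ### General linear combinations -/

/-- Over an infinite field, a general linear combination of given polynomials avoids finitely many
ideals, none of which contains all of the polynomials. -/
theorem exists_sum_C_mul_notMem [Infinite k] (v : Fin 3 → R k) {S : Set (Ideal (R k))}
    (hS : S.Finite) (h : ∀ P ∈ S, ∃ i, v i ∉ P) :
    ∃ c : Fin 3 → k, ∀ P ∈ S, ∑ i, C (c i) * v i ∉ P := by
  let φ : (Fin 3 → k) →ₗ[k] R k := Fintype.linearCombination k v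
  have hφ : ∀ c, φ c = ∑ i, C (c i) * v i := fun c => by
    simp [φ, Fintype.linearCombination_apply, smul_eq_C_mul]
  let F : Ideal (R k) → Subspace k (Fin 3 → k) := fun P => (P.restrictScalars k).comap φ
  have hne := Subspace.biUnion_ne_univ_of_top_notMem (s := (hS.image F).toFinset) (by
    rw [Set.Finite.mem_toFinset]
    rintro ⟨P, hP, hPtop⟩
    obtain ⟨i, hi⟩ := h P hP
    have hmem : Pi.single i 1 ∈ F P := hPtop ▸ Submodule.mem_top
    refine hi ?_
    simpa [F, φ, Fintype.linearCombination_apply_single] using hmem)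
  obtain ⟨c, hc⟩ := (Set.ne_univ_iff_exists_notMem _).1 hne
  refine ⟨c, fun P hP hmem => hc ?_⟩
  rw [← hφ] at hmem
  exact Set.mem_iUnion₂.2 ⟨F P, (Set.Finite.mem_toFinset _).2 (Set.mem_image_of_mem F hP), hmem⟩

/-- The ideal of a primitive vector of forms of degree `e` contains two coprime forms of
degree `e`. -/
theorem IsPrimitive.exists_isRelPrime [Infinite k] {v : Fin 3 → R k} (hv : IsPrimitive v) {e : ℕ}
    (he : IsHomogVec v e) {I : Ideal (R k)} (hI : ∀ i, v i ∈ I) :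
    ∃ p q : R k, p ≠ 0 ∧ q ≠ 0 ∧ IsRelPrime p q ∧ p ∈ I ∧ q ∈ I ∧ p.IsHomogeneous e ∧
      q.IsHomogeneous e := by
  classical
  obtain ⟨i, hi⟩ := hv.exists_ne_zero
  obtain ⟨s, hs, hsp⟩ := UniqueFactorizationMonoid.exists_prime_factors (v i) hi
  obtain ⟨c, hc⟩ := exists_sum_C_mul_notMem v
    (S := insert ⊥ ((fun π => Ideal.span {π}) '' {π | π ∈ s}))
    (((Multiset.finite_toSet s).image _).insert _) (by
      rintro _ (rfl | ⟨π, hπ, rfl⟩)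
      · exact ⟨i, hi⟩
      by_contra! h
      exact (hs π hπ).not_isUnit (hv π fun j => Ideal.mem_span_singleton.1 (h j)))
  refine ⟨v i, ∑ j, C (c j) * v j, hi, hc ⊥ (Set.mem_insert _ _),
    fun q hqp hq => ?_, hI i,
    Ideal.sum_mem _ fun j _ => I.mul_mem_left _ (hI j), he i,
    IsHomogeneous.sum _ _ _ fun j _ => (he j).C_mul _⟩
  by_contra hu
  obtain ⟨π, hπ, hπq⟩ := WfDvdMonoid.exists_irreducible_factor hu (ne_zero_of_dvd_ne_zero hi hqp)
  obtain ⟨ρ, hρ, hπρ⟩ := hπ.prime.exists_mem_multiset_dvd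
    ((hπq.trans hqp).trans hsp.symm.dvd)
  have hassoc := hπ.associated_of_dvd (hs ρ hρ).irreducible hπρ
  exact hc _ (Or.inr ⟨ρ, hρ, rfl⟩) (Ideal.mem_span_singleton.2 (hassoc.symm.dvd.trans (hπq.trans hq)))

/-- A general line misses the finitely many common zeros of two coprime forms: the forms together
with the equation of the line generate an ideal containing a power of `𝔪`. -/
theorem exists_linear_pow_le [Infinite k] {p q : R k} {e : ℕ} (hp0 : p ≠ 0)
    (hpq : IsRelPrime p q) (hp : p.IsHomogeneous e) (hq : q.IsHomogeneous e) :
    ∃ l : R k, l.IsHomogeneous 1 ∧ ∃ N, idealOfVars (Fin 3) k ^ N ≤ Ideal.span {p, q, l} := by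
  obtain ⟨c, hc⟩ := exists_sum_C_mul_notMem (X : Fin 3 → R k)
    (S := {P ∈ (Ideal.span {p, q}).minimalPrimes | ¬ idealOfVars (Fin 3) k ≤ P})
    ((Ideal.finite_minimalPrimes_of_isNoetherianRing _ _).subset (Set.sep_subset _ _)) (by
      rintro P ⟨-, hP⟩
      by_contra! h
      exact hP (Ideal.span_le.2 (Set.range_subset_iff.2 h)))
  set l : R k := ∑ i, C (c i) * X i
  have hl1 : l.IsHomogeneous 1 := IsHomogeneous.sum _ _ _ fun i _ => isHomogeneous_C_mul_X _ _
  refine ⟨l, hl1, Ideal.exists_pow_le_of_le_radical_of_fg ?_ (idealOfVars_fg (Fin 3) k)⟩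
  rw [Ideal.radical_eq_sInf, le_sInf_iff]
  rintro Q ⟨hle, hQ⟩
  -- It suffices to treat the homogeneous prime `T` contained in `Q`.
  set T := (Q.homogeneousCore (homogeneousSubmodule (Fin 3) k)).toIdeal
  have hTP : T.IsPrime := hQ.homogeneousCore
  have hTQ : T ≤ Q := Ideal.toIdeal_homogeneousCore_le _ _
  have hmem : ∀ g : R k, ∀ n, g.IsHomogeneous n → g ∈ Ideal.span {p, q, l} → g ∈ T :=
    fun g n hg hgm => Ideal.mem_homogeneousCore_of_homogeneous_of_mem ⟨n, hg⟩ (hle hgm)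
  have hpT : p ∈ T := hmem p e hp (Ideal.subset_span (by simp))
  have hqT : q ∈ T := hmem q e hq (Ideal.subset_span (by simp))
  have hlT : l ∈ T := hmem l 1 hl1 (Ideal.subset_span (by simp))
  obtain ⟨P, hP, hPT⟩ := Ideal.exists_minimalPrimes_le (I := Ideal.span {p, q}) (J := T)
    (Ideal.span_le.2 (by rintro _ (rfl | rfl) <;> assumption))
  by_cases hmP : idealOfVars (Fin 3) k ≤ P
  · exact hmP.trans (hPT.trans hTQ)
  -- Otherwise `P < T`, so that `T` has height three and is the irrelevant ideal.
  have := hP.isPrime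
  have hlt : P < T := lt_of_le_of_ne hPT fun h => hc P ⟨hP, hmP⟩ (h ▸ hlT)
  have h2 : 2 ≤ P.height := two_le_height_of_isRelPrime hp0 hpq
    (hP.1.2 (Ideal.subset_span (by simp))) (hP.1.2 (Ideal.subset_span (by simp)))
  by_cases hTm : T = idealOfVars (Fin 3) k
  · exact hTm ▸ hTQ
  · have h3 := Ideal.height_add_one_le_of_lt_of_isPrime hlt
    have h4 := height_le_two_of_isHomogeneous (HomogeneousIdeal.isHomogeneous _) hTm
    have h5 : (2 : ℕ∞) + 1 ≤ 2 := (add_le_add_left h2 1).trans (h3.trans h4)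
    exact absurd h5 (by decide)

end PlaneCurve

/-! ### Hilbert functions -/

namespace PlaneCurve

variable {k : Type*} [Field k]

theorem finrank_map_add_finrank_inf_ker {V W : Type*} [AddCommGroup V] [Module k V]
    [AddCommGroup W] [Module k W] (φ : V →ₗ[k] W) (S : Submodule k V) [Module.Finite k S] :
    Module.finrank k (S.map φ) + Module.finrank k (S ⊓ LinearMap.ker φ : Submodule k V) =
      Module.finrank k S := by
  have h := LinearMap.finrank_range_add_finrank_ker (φ.domRestrict S)
  rw [LinearMap.range_domRestrict, LinearMap.ker_domRestrict] at h
  rw [← h, ← Submodule.map_comap_subtype, Submodule.finrank_map_subtype_eq]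

instance finite_homogeneousSubmodule {σ : Type*} [Finite σ] (n : ℕ) :
    Module.Finite k (homogeneousSubmodule σ k n) :=
  Module.Finite.iff_fg.2 (homogeneousSubmodule_fg σ k n)

theorem finrank_homogeneousSubmodule (n : ℕ) :
    Module.finrank k (homogeneousSubmodule (Fin 3) k n) = (n + 2).choose 2 := by
  have hb := Module.finrank_eq_nat_card_basis
    (basisRestrictSupport k {d : Fin 3 →₀ ℕ | d.degree = n})
  have hs : homogeneousSubmodule (Fin 3) k n =
      restrictSupport k {d : Fin 3 →₀ ℕ | d.degree = n} :=
    homogeneousSubmodule_eq_finsupp_supported (Fin 3) k n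
  rw [hs, hb]
  have hset : {d : Fin 3 →₀ ℕ | d.degree = n} =
      ((Finset.univ : Finset (Fin 3)).finsuppAntidiag n : Set (Fin 3 →₀ ℕ)) := by
    ext m
    simp [Finset.mem_finsuppAntidiag, Finsupp.degree_eq_sum]
  rw [hset, Nat.card_coe_set_eq, Set.ncard_coe_finset, Finset.card_finsuppAntidiag_nat_eq_choose]
  simp only [Finset.card_univ, Fintype.card_fin]
  rw [show 3 + n - 1 = n + 2 by omega, Nat.choose_symm_add]

/-- The degree `n` part of an ideal. -/
noncomputable def gradedPiece (I : Ideal (R k)) (n : ℕ) : Submodule k (R k) :=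
  homogeneousSubmodule (Fin 3) k n ⊓ I.restrictScalars k

theorem mem_gradedPiece {I : Ideal (R k)} {n : ℕ} {g : R k} :
    g ∈ gradedPiece I n ↔ g.IsHomogeneous n ∧ g ∈ I := Iff.rfl

instance (I : Ideal (R k)) (n : ℕ) : Module.Finite k (gradedPiece I n) :=
  Submodule.finiteDimensional_of_le (inf_le_left :
    gradedPiece I n ≤ homogeneousSubmodule (Fin 3) k n)

theorem hilbertFn_add_finrank_gradedPiece (I : Ideal (R k)) (n : ℕ) :
    hilbertFn I n + Module.finrank k (gradedPiece I n) = (n + 2).choose 2 := by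
  have h := finrank_map_add_finrank_inf_ker (Ideal.Quotient.mkₐ k I).toLinearMap
    (homogeneousSubmodule (Fin 3) k n)
  have hker : LinearMap.ker (Ideal.Quotient.mkₐ k I).toLinearMap = I.restrictScalars k := by
    ext g
    simp [Ideal.Quotient.eq_zero_iff_mem]
  rw [hker, finrank_homogeneousSubmodule] at h
  exact h

theorem finrank_map_mul_left {p : R k} (hp : p ≠ 0) (n : ℕ) :
    Module.finrank k ((homogeneousSubmodule (Fin 3) k n).map (LinearMap.mulLeft k p)) =
      (n + 2).choose 2 := by
  rw [← finrank_homogeneousSubmodule (k := k) n]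
  exact (Submodule.equivMapOfInjective (LinearMap.mulLeft k p)
    (fun a b h => mul_left_cancel₀ hp h) _).finrank_eq.symm

/-- The upper bound `e²` in Bézout's theorem for two coprime forms of degree `e`. -/
theorem hilbertFn_le_sq {I : Ideal (R k)} {p q : R k} {e : ℕ} (hp0 : p ≠ 0) (hq0 : q ≠ 0)
    (hpq : IsRelPrime p q) (hp : p.IsHomogeneous e) (hq : q.IsHomogeneous e) (hpI : p ∈ I)
    (hqI : q ∈ I) (m : ℕ) : hilbertFn I (m + 2 * e) ≤ e ^ 2 := by
  set A := (homogeneousSubmodule (Fin 3) k (m + e)).map (LinearMap.mulLeft k p)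
  set B := (homogeneousSubmodule (Fin 3) k (m + e)).map (LinearMap.mulLeft k q)
  have hAB : A ⊔ B ≤ gradedPiece I (m + 2 * e) := by
    refine sup_le ?_ ?_
    · rintro _ ⟨r, hr, rfl⟩
      refine mem_gradedPiece.2 ⟨?_, I.mul_mem_right _ hpI⟩
      convert! hp.mul hr using 1
      ring
    · rintro _ ⟨r, hr, rfl⟩
      refine mem_gradedPiece.2 ⟨?_, I.mul_mem_right _ hqI⟩
      convert! hq.mul hr using 1
      ring
  have hinf : A ⊓ B ≤ (homogeneousSubmodule (Fin 3) k m).map (LinearMap.mulLeft k (p * q)) := by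
    rintro _ ⟨⟨r, hr, rfl⟩, ⟨s, hs, hrs⟩⟩
    simp only [LinearMap.mulLeft_apply] at hrs
    obtain ⟨t, rfl⟩ := hpq.symm.dvd_of_dvd_mul_left (Dvd.intro _ hrs)
    refine ⟨t, ?_, by simp⟩
    rcases eq_zero_or_exists_isHomogeneous_of_mul hq hq0
      (by rw [mul_comm]; exact hr : (t * q).IsHomogeneous (m + e)) with rfl | ⟨j, hj, ht⟩
    · exact Submodule.zero_mem _
    · rwa [Nat.add_right_cancel hj] at ht
  have h1 := Submodule.finrank_sup_add_finrank_inf_eq A B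
  have h2 := Submodule.finrank_mono hAB
  have h3 := Submodule.finrank_mono hinf
  have h4 := hilbertFn_add_finrank_gradedPiece I (m + 2 * e)
  rw [finrank_map_mul_left hp0, finrank_map_mul_left hq0] at h1
  rw [finrank_map_mul_left (mul_ne_zero hp0 hq0)] at h3
  have h5 : (m + 2 * e + 2).choose 2 + (m + 2).choose 2 =
      2 * (m + e + 2).choose 2 + e ^ 2 := by
    have hc : ∀ a : ℕ, ((a + 2).choose 2 : ℚ) = (a + 2) * (a + 1) / 2 := fun a => by
      rw [Nat.cast_choose_two]; push_cast; ring
    have : (((m + 2 * e + 2).choose 2 + (m + 2).choose 2 : ℕ) : ℚ) =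
        ((2 * (m + e + 2).choose 2 + e ^ 2 : ℕ) : ℚ) := by
      push_cast
      rw [hc, hc, hc]
      push_cast
      ring
    exact_mod_cast this
  omega

/-- If `R/(p, q, l)` vanishes in large degrees, then multiplication by the linear form `l` is
eventually surjective on `R/I`. -/
theorem hilbertFn_succ_le {I : Ideal (R k)}
    (hI : I.IsHomogeneous (homogeneousSubmodule (Fin 3) k)) {p q l : R k} (hp : p ∈ I)
    (hq : q ∈ I) (hl : l.IsHomogeneous 1) {N : ℕ}
    (hN : idealOfVars (Fin 3) k ^ N ≤ Ideal.span {p, q, l}) {n : ℕ} (hn : N ≤ n + 1) :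
    hilbertFn I (n + 1) ≤ hilbertFn I n := by
  set V := (homogeneousSubmodule (Fin 3) k n).map (Ideal.Quotient.mkₐ k I).toLinearMap
  have hle : (homogeneousSubmodule (Fin 3) k (n + 1)).map (Ideal.Quotient.mkₐ k I).toLinearMap ≤
      V.map (LinearMap.mulRight k (Ideal.Quotient.mkₐ k I l)) := by
    rintro _ ⟨g, hg, rfl⟩
    have hgN : g ∈ Ideal.span {p, q, l} := hN (by
      rw [mem_pow_idealOfVars_iff']
      intro m hm
      exact IsHomogeneous.coeff_eq_zero hg (by omega))
    rw [Ideal.mem_span_insert] at hgN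
    obtain ⟨a, h, hh, rfl⟩ := hgN
    obtain ⟨b, c, rfl⟩ := Ideal.mem_span_pair.1 hh
    have hmem : a * p + b * q ∈ I := I.add_mem (I.mul_mem_left _ hp) (I.mul_mem_left _ hq)
    have hg' := homogeneousComponent_eq_self hg
    rw [← add_assoc, map_add, homogeneousComponent_mul_of_isHomogeneous hl] at hg'
    refine ⟨Ideal.Quotient.mkₐ k I (homogeneousComponent n c),
      ⟨_, homogeneousComponent_mem n c, rfl⟩, ?_⟩
    rw [← add_assoc, ← hg', map_add]
    simp only [LinearMap.mulRight_apply, AlgHom.toLinearMap_apply, Ideal.Quotient.mkₐ_eq_mk,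
      map_mul]
    rw [Ideal.Quotient.eq_zero_iff_mem.2 (homogeneousComponent_mem_of_mem hI hmem (n + 1)),
      zero_add]
  exact (Submodule.finrank_mono hle).trans (Submodule.finrank_map_le _ _)

theorem exists_eventually_eq_of_succ_le {a : ℕ → ℕ} {N : ℕ} (h : ∀ n, N ≤ n → a (n + 1) ≤ a n) :
    ∃ b, ∀ᶠ n in Filter.atTop, a n = b := by
  obtain ⟨n₀, hn₀, hmin⟩ : ∃ n₀, N ≤ n₀ ∧ ∀ n, N ≤ n → a n₀ ≤ a n := by
    obtain ⟨n₀, hn₀, h₀⟩ := Nat.sInf_mem (s := a '' Set.Ici N) ⟨_, N, Set.self_mem_Ici, rfl⟩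
    exact ⟨n₀, hn₀, fun n hn => h₀.trans_le (Nat.sInf_le ⟨n, hn, rfl⟩)⟩
  refine ⟨a n₀, Filter.eventually_atTop.2 ⟨n₀, fun n hn => le_antisymm ?_ (hmin n (hn₀.trans hn))⟩⟩
  induction n, hn using Nat.le_induction with
  | base => exact le_rfl
  | succ n hn ih => exact (h n (hn₀.trans hn)).trans ih

/-! ### The Hilbert function of a Bourbaki ideal -/

section Bourbaki

variable {f : R k} {d e : ℕ} {ε : Syz f} {u : Syz f →ₗ[R k] R k}

/-- The components of `u σ` are the images of the components of `σ`. -/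
theorem homogeneousComponent_eq_of_forall_isHomogVec (hf : f.IsHomogeneous (d + 1))
    (hu : ∀ (n : ℕ) (σ : Syz f), IsHomogVec (σ : Fin 3 → R k) n →
      u σ = 0 ∨ ∃ j : ℕ, j + d = n + e ∧ (u σ).IsHomogeneous j) (σ : Syz f) {j n : ℕ}
    (hjn : j + d = n + e) :
    homogeneousComponent j (u σ) = u ⟨_, vecComponent_mem_syz hf σ.2 n⟩ := by
  obtain ⟨N, hN⟩ := exists_forall_sum_vecComponent (σ : Fin 3 → R k)
  have hσ : σ = ∑ m ∈ Finset.range (N + n + 1),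
      (⟨_, vecComponent_mem_syz hf σ.2 m⟩ : Syz f) := by
    refine Subtype.ext ?_
    rw [Submodule.coe_sum, hN _ (by omega)]
  conv_lhs => rw [hσ, map_sum, map_sum]
  rw [Finset.sum_eq_single n]
  · rcases hu n ⟨_, vecComponent_mem_syz hf σ.2 n⟩ (isHomogVec_vecComponent n _) with h | ⟨i, hi, h⟩
    · rw [h, map_zero]
    · obtain rfl : i = j := by omega
      exact homogeneousComponent_eq_self h
  · intro m _ hm
    rcases hu m ⟨_, vecComponent_mem_syz hf σ.2 m⟩ (isHomogVec_vecComponent m _) with h | ⟨i, hi, h⟩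
    · rw [h, map_zero]
    · rw [homogeneousComponent_of_mem h, if_neg (by omega)]
  · intro h
    exact absurd (Finset.mem_range.2 (by omega)) h

/-- The image of a graded homomorphism is a homogeneous ideal. -/
theorem isHomogeneous_range (hf : f.IsHomogeneous (d + 1))
    (hu : ∀ (n : ℕ) (σ : Syz f), IsHomogVec (σ : Fin 3 → R k) n →
      u σ = 0 ∨ ∃ j : ℕ, j + d = n + e ∧ (u σ).IsHomogeneous j) :
    (LinearMap.range u : Ideal (R k)).IsHomogeneous (homogeneousSubmodule (Fin 3) k) := by
  have hspan : (LinearMap.range u : Ideal (R k)) =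
      Ideal.span {g | ∃ n, ∃ σ : Syz f, IsHomogVec (σ : Fin 3 → R k) n ∧ u σ = g} := by
    refine le_antisymm ?_ (Ideal.span_le.2 ?_)
    · rintro _ ⟨σ, rfl⟩
      obtain ⟨N, hN⟩ := exists_forall_sum_vecComponent (σ : Fin 3 → R k)
      have hσ : σ = ∑ m ∈ Finset.range N, (⟨_, vecComponent_mem_syz hf σ.2 m⟩ : Syz f) :=
        Subtype.ext (by rw [Submodule.coe_sum, hN _ le_rfl])
      rw [hσ, map_sum]
      exact Ideal.sum_mem _ fun m _ =>
        Ideal.subset_span ⟨m, _, isHomogVec_vecComponent m _, rfl⟩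
    · rintro _ ⟨n, σ, -, rfl⟩
      exact ⟨σ, rfl⟩
  rw [hspan]
  refine Ideal.homogeneous_span _ _ ?_
  rintro _ ⟨n, σ, hσ, rfl⟩
  rcases hu n σ hσ with h | ⟨j, -, h⟩
  · rw [h]
    exact ⟨0, Submodule.zero_mem _⟩
  · exact ⟨j, h⟩

/-- The degree `n` part of the syzygy module. -/
noncomputable def syzDegree (f : R k) (n : ℕ) : Submodule k (Syz f) where
  carrier := {σ | IsHomogVec (σ : Fin 3 → R k) n}
  add_mem' ha hb i := (ha i).add (hb i)
  zero_mem' _ := isHomogeneous_zero _ _ _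
  smul_mem' c _ h i := (homogeneousSubmodule (Fin 3) k n).smul_mem c (h i)

instance (f : R k) (n : ℕ) : Module.Finite k (syzDegree f n) := by
  let φ : syzDegree f n →ₗ[k] (Fin 3 → homogeneousSubmodule (Fin 3) k n) :=
    { toFun σ i := ⟨(σ : Syz f).1 i, σ.2 i⟩
      map_add' _ _ := rfl
      map_smul' _ _ := rfl }
  refine Module.Finite.of_injective φ fun a b h => ?_
  refine Subtype.ext (Subtype.ext (funext fun i => ?_))
  exact congrArg Subtype.val (congrFun h i)

/-- Rank-nullity in the Bourbaki sequence. In particular, the dimensions of the graded pieces of a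
Bourbaki ideal do not depend on the choice of `ε` and of the ideal. -/
theorem IsBourbakiIdeal.finrank_gradedPiece {I : Ideal (R k)} (hf : f.IsHomogeneous (d + 1))
    (hε : IsHomogVec (ε : Fin 3 → R k) e) (hε0 : (ε : Fin 3 → R k) ≠ 0)
    (h : IsBourbakiIdeal f d e ε I) {j m : ℕ} (hjm : j + d = m + e + e) :
    Module.finrank k (gradedPiece I j) + (m + 2).choose 2 =
      Module.finrank k (syzDegree f (m + e)) := by
  obtain ⟨-, -, u, hker, hrange, hu⟩ := h
  rw [← finrank_map_add_finrank_inf_ker (u.restrictScalars k) (syzDegree f (m + e))]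
  congr 1
  · suffices h : gradedPiece I j = (syzDegree f (m + e)).map (u.restrictScalars k) by rw [h]
    ext g
    rw [mem_gradedPiece, ← hrange]
    constructor
    · rintro ⟨hg, σ, rfl⟩
      refine ⟨⟨_, vecComponent_mem_syz hf σ.2 (m + e)⟩, isHomogVec_vecComponent _ _, ?_⟩
      have := homogeneousComponent_eq_of_forall_isHomogVec hf hu σ hjm
      rw [homogeneousComponent_eq_self hg] at this
      exact this.symm
    · rintro ⟨σ, hσ, rfl⟩
      refine ⟨?_, σ, rfl⟩
      rcases hu _ σ hσ with h0 | ⟨i, hi, h⟩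
      · rw [LinearMap.restrictScalars_apply, h0]
        exact isHomogeneous_zero _ _ _
      · obtain rfl : i = j := by omega
        exact h
  · have hmap : syzDegree f (m + e) ⊓ LinearMap.ker (u.restrictScalars k) =
        (homogeneousSubmodule (Fin 3) k m).map
          ((LinearMap.toSpanSingleton (R k) (Syz f) ε).restrictScalars k) := by
      obtain ⟨i, hi⟩ := Function.ne_iff.1 hε0
      ext σ
      constructor
      · rintro ⟨hσ, hσu⟩
        have hσ' : σ ∈ LinearMap.ker u := hσu
        rw [hker] at hσ'
        obtain ⟨r, rfl⟩ := Submodule.mem_span_singleton.1 hσ'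
        refine ⟨r, ?_, rfl⟩
        rcases eq_zero_or_exists_isHomogeneous_of_mul (hε i) hi (hσ i) with rfl | ⟨t, ht, h⟩
        · exact Submodule.zero_mem _
        · rwa [Nat.add_right_cancel ht] at h
      · rintro ⟨r, hr, rfl⟩
        refine ⟨fun i => IsHomogeneous.mul hr (hε i), ?_⟩
        have : r • ε ∈ LinearMap.ker u := by
          rw [hker]
          exact Submodule.smul_mem _ _ (Submodule.mem_span_singleton_self ε)
        exact this
    rw [hmap, ← finrank_homogeneousSubmodule (k := k) m]
    have hε0' : ε ≠ 0 := fun h => hε0 (by rw [h]; rfl)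
    exact (Submodule.equivMapOfInjective
      ((LinearMap.toSpanSingleton (R k) (Syz f) ε).restrictScalars k)
      (smul_left_injective (R k) hε0') _).finrank_eq

theorem IsBourbakiIdeal.hilbertFn_eq {ε' : Syz f} {I I' : Ideal (R k)}
    (hf : f.IsHomogeneous (d + 1))
    (hε : IsHomogVec (ε : Fin 3 → R k) e) (hε0 : (ε : Fin 3 → R k) ≠ 0)
    (hε' : IsHomogVec (ε' : Fin 3 → R k) e) (hε0' : (ε' : Fin 3 → R k) ≠ 0)
    (h : IsBourbakiIdeal f d e ε I) (h' : IsBourbakiIdeal f d e ε' I') {j : ℕ} (hj : 2 * e ≤ j) :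
    hilbertFn I j = hilbertFn I' j := by
  have hjm : j + d = j + d - 2 * e + e + e := by omega
  have h1 := h.finrank_gradedPiece hf hε hε0 hjm
  have h2 := h'.finrank_gradedPiece hf hε' hε0' hjm
  have h3 := hilbertFn_add_finrank_gradedPiece I j
  have h4 := hilbertFn_add_finrank_gradedPiece I' j
  omega

end Bourbaki

end PlaneCurve

/-! ### Existence and degree of Bourbaki ideals -/

namespace PlaneCurve

/-- Every nonzero syzygy of initial degree `e` has a Bourbaki ideal, and the Hilbert function of
that ideal is eventually constant with value at most `e²`. -/
theorem exists_isBourbakiIdeal {k : Type*} [Field k] [Infinite k] {f : R k} {d : ℕ}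
    (hf : f.IsHomogeneous (d + 1)) (hprim : IsPrimitive fun i => pderiv i f) {ε : Syz f}
    (hε : IsHomogVec (ε : Fin 3 → R k) (indegSyz f)) (hε0 : (ε : Fin 3 → R k) ≠ 0) :
    ∃ I : Ideal (R k), IsBourbakiIdeal f d (indegSyz f) ε I ∧
      ∃ b, HasDegree I b ∧ b ≤ indegSyz f ^ 2 := by
  have hεprim := isPrimitive_of_isHomogVec_indegSyz hf ε.2 hε0 hε
  obtain ⟨u, hu⟩ := exists_linearMap_cross_eq_smul hprim ε.2
  have hker := ker_eq_span_of_cross_eq_smul hprim hεprim hu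
  have hdeg := isHomogeneous_of_cross_eq_smul hf hprim hε hu
  have hhom := isHomogeneous_range hf hdeg
  obtain ⟨p, q, hp0, hq0, hpq, hpI, hqI, hp, hq⟩ :=
    hεprim.exists_isRelPrime hε (I := LinearMap.range u) (apply_mem_range_of_cross_eq_smul hprim hu)
  refine ⟨LinearMap.range u, ⟨hhom, or_iff_not_imp_left.2 fun htop => ?_, u, hker, rfl, hdeg⟩, ?_⟩
  · exact height_eq_two_of_colon hhom htop hp0 hpq hpI hqI fun g hg =>
      mem_range_of_forall_X_mul_mem hε0 hker hg
  · obtain ⟨l, hl, N, hN⟩ := exists_linear_pow_le hp0 hpq hp hq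
    obtain ⟨b, hb⟩ := exists_eventually_eq_of_succ_le (a := hilbertFn (LinearMap.range u)) (N := N)
      fun n hn => hilbertFn_succ_le hhom hpI hqI hl hN (hn.trans n.le_succ)
    refine ⟨b, hb, ?_⟩
    obtain ⟨n, hn, hn'⟩ := (hb.and (Filter.eventually_ge_atTop (2 * indegSyz f))).exists
    rw [← hn, ← Nat.sub_add_cancel hn']
    exact hilbertFn_le_sq hp0 hq0 hpq hp hq hpI hqI _

end PlaneCurve

theorem mainTheorem2 {k : Type*} [Field k] [IsAlgClosed k] (d : ℕ) (hd : 1 ≤ d)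
    (hchar : ((d + 1 : ℕ) : k) ≠ 0)
    (f : PlaneCurve.R k) (hf0 : f ≠ 0) (hf : f.IsHomogeneous (d + 1))
    (hred : (Ideal.span {f}).IsRadical) (hsing : PlaneCurve.IsSingular f) :
    ∃ b : ℕ, PlaneCurve.IsBourbakiDegree f d b ∧ b ≤ PlaneCurve.indegSyz f ^ 2 := by
  have : Infinite k := IsAlgClosed.instInfinite
  have hsq : Squarefree f :=
    (isRadical_iff_squarefree_of_ne_zero hf0).1 (isRadical_iff_span_singleton.2 hred)
  have hprim := PlaneCurve.isPrimitive_pderiv hf hchar hf0 hsq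
  obtain ⟨ε, hεS, hε0, hε⟩ := PlaneCurve.exists_isHomogVec_indegSyz hf hprim.exists_ne_zero
  obtain ⟨I, hI, b, hb, hle⟩ :=
    PlaneCurve.exists_isBourbakiIdeal hf hprim (ε := ⟨ε, hεS⟩) hε hε0
  refine ⟨b, ⟨⟨⟨ε, hεS⟩, I, (PlaneCurve.isMinimalGenerator_indegSyz_iff hf).2 ⟨hε, hε0⟩, hI⟩, ?_⟩,
    hle⟩
  intro ε' I' hε' hI'
  obtain ⟨hε'1, hε'0⟩ := (PlaneCurve.isMinimalGenerator_indegSyz_iff hf).1 hε'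
  filter_upwards [hb, Filter.eventually_ge_atTop (2 * PlaneCurve.indegSyz f)] with n hn hn'
  rw [← hn]
  exact hI'.hilbertFn_eq hf hε'1 hε'0 hε hε0 hI hn'
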